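/- Let $\mathbb{A}$ be a real algebra with unity (not necessarily associative), of finite dimension $d+1$, which is alternative (the associator $(ab)c-a(bc)$ is alternating) and is equipped with a real-linear anti-involution $a\mapsto a^{c}$, i.e. $(a^c)^c=a$ and $(ab)^c=b^ca^c$. Let $\mathbb{S}_{\mathbb{A}}=\{x\in\mathbb{A}: x+x^c=0,\ xx^c=1\}$ and let $$Q_{\mathbb{A}}=\mathbb{R}\cup\{x\in\mathbb{A}: t(x)=x+x^c\in\mathbb{R},\ n(x)=xx^c\in\mathbb{R},\ 4n(x)>t(x)^2\}.$$ Let $M$ be a real vector subspace with $\mathbb{R}\subsetneq M\subseteq Q_{\mathbb{A}}$, and let $(v_0,v_1,\dots,v_m)$ be a basis of $M$ with $m\ge 1$, $v_0=1$, $v_s\in\mathbb{S}_{\mathbb{A}}$ and $v_sv_t=-v_tv_s$ for all distinct $s,t\in\{1,\dots,m\}$. Complete it to a real basis $(v_0,\dots,v_m,\dots,v_d)$ of $\mathbb{A}$. Identify $M$ with the Euclidean space $\mathbb{R}^{m+1}$ via $(x_0,\dots,x_m)\mapsto\sum_{s=0}^m x_sv_s$. Let $\Omega\subseteq M$ be a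 domain (a non-empty connected open set), and let $f=\sum_{t=0}^d v_tf_t:\Omega\to\mathbb{A}$ be (left) monogenic, i.e. the real components $f_t$ are of class $C^1$ on $\Omega$ and $$\sum_{s=0}^m v_s\frac{\partial f}{\partial x_s}(x)=\sum_{s=0}^m\sum_{t=0}^d v_sv_t\,\frac{\partial f_t}{\partial x_s}(x)=0,\qquad x\in\Omega.$$ Then, for every $x\in\Omega$ and every $\epsilon>0$ such that the closed ball $\{y\in M:|y-x|\le\epsilon\}$ is contained in $\Omega$, $$f(x)=\frac{1}{\sigma_m\epsilon^m}\int_{\partial B(x,\epsilon)}f\,dS .$$ Here $\partial B(x,\epsilon)=\{y\in M:|y-x|=\epsilon\}$, $dS$ is the Lebesgue surface measure, $\int f\,dS=\sum_{t=0}^d v_t\int f_t\,dS$ is taken componentwise, and $\sigma_m=2\,\Gamma(\tfrac12)^{m+1}/\Gamma(\tfrac{m+1}{2})$ is the area of the unit sphere in $\mathbb{R}^{m+1}$. -/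

import Mathlib

open MeasureTheory

noncomputable section

namespace Hypercomplex

/-- A (not necessarily associative) ring is alternative if its associator
`(a * b) * c - a * (b * c)`, which is always additive in each argument, is alternating:
it vanishes as soon as two of its arguments coincide. -/
def IsAlternative (A : Type*) [NonAssocRing A] : Prop :=
  ∀ a b : A, associator a a b = 0 ∧ associator a b b = 0 ∧ associator a b a = 0

section Algebra

variable (A : Type*) [NonAssocRing A] [StarRing A]

/-- The imaginary units of a `*`-algebra: the elements of trace `x + xᶜ = 0` and
(squared) norm `x xᶜ = 1`. -/
def imaginaryUnits : Set A :=
  {x | x + star x = 0 ∧ x * star x = 1}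

/-- The quadratic cone: the real numbers, together with the `x` whose trace `x + xᶜ` and norm
`x xᶜ` are real numbers `t`, `n` with `4 n > t ^ 2`. -/
def quadraticCone [Module ℝ A] : Set A :=
  {x | ∃ r : ℝ, x = r • (1 : A)} ∪
    {x | ∃ t n : ℝ, x + star x = t • (1 : A) ∧ x * star x = n • (1 : A) ∧ t ^ 2 < 4 * n}

variable {A}

/-- A hypercomplex subspace: a real subspace `M` with `ℝ ⊊ M ⊆ Q_A`. -/
def IsHypercomplexSubspace [Module ℝ A] (M : Submodule ℝ A) : Prop :=
  Submodule.span ℝ {(1 : A)} < M ∧ (M : Set A) ⊆ quadraticCone A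

/-- A hypercomplex basis `(v₀, …, v_m)` of `M`: `m ≥ 1`, `v₀ = 1`, and `v₁, …, v_m` are
pairwise anticommuting imaginary units. -/
def IsHypercomplexBasis [Module ℝ A] {M : Submodule ℝ A} {m : ℕ}
    (v : Module.Basis (Fin (m + 1)) ℝ M) : Prop :=
  1 ≤ m ∧ (v 0 : A) = 1 ∧ (∀ s, s ≠ 0 → (v s : A) ∈ imaginaryUnits A) ∧
    ∀ s t, s ≠ 0 → t ≠ 0 → s ≠ t → (v s : A) * (v t : A) = -((v t : A) * (v s : A))

end Algebra

section Analysis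

/-! Points `(x₀, …, x_m)` of `ℝ^{m+1}` stand for the points `∑ x_s v_s` of `M`; the Euclidean norm
of `A` attached to a basis of `A` that extends `v` restricts on `M` to that of `ℝ^{m+1}`. -/

variable {A : Type*} [NonAssocRing A] [Module ℝ A] {m d : ℕ}

/-- The real component `f_t` of `f = ∑ t, f_t b_t`. -/
def component (b : Module.Basis (Fin (d + 1)) ℝ A) (f : EuclideanSpace ℝ (Fin (m + 1)) → A)
    (t : Fin (d + 1)) (x : EuclideanSpace ℝ (Fin (m + 1))) : ℝ :=
  b.repr (f x) t

/-- The partial derivative `∂g/∂x_s` of a real function. -/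
def partialDeriv (s : Fin (m + 1)) (g : EuclideanSpace ℝ (Fin (m + 1)) → ℝ)
    (x : EuclideanSpace ℝ (Fin (m + 1))) : ℝ :=
  fderiv ℝ g x (EuclideanSpace.single s 1)

/-- The Cauchy-Riemann operator `∑ s, v_s ∂f/∂x_s = ∑ s, ∑ t, v_s b_t ∂f_t/∂x_s`, acting from
the left. -/
def cauchyRiemann {M : Submodule ℝ A} (v : Module.Basis (Fin (m + 1)) ℝ M)
    (b : Module.Basis (Fin (d + 1)) ℝ A) (f : EuclideanSpace ℝ (Fin (m + 1)) → A)
    (x : EuclideanSpace ℝ (Fin (m + 1))) : A :=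
  ∑ s, ∑ t, partialDeriv s (component b f t) x • ((v s : A) * b t)

/-- `f` is (left) monogenic on the open set `Ω`: its components are `C¹` on `Ω`, and the
Cauchy-Riemann operator annihilates it on `Ω`. -/
def IsMonogenicOn {M : Submodule ℝ A} (v : Module.Basis (Fin (m + 1)) ℝ M)
    (b : Module.Basis (Fin (d + 1)) ℝ A) (f : EuclideanSpace ℝ (Fin (m + 1)) → A)
    (Ω : Set (EuclideanSpace ℝ (Fin (m + 1)))) : Prop :=
  (∀ t, ContDiffOn ℝ 1 (component b f t) Ω) ∧ ∀ x ∈ Ω, cauchyRiemann v b f x = 0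

/-- Surface measure `dS` of the sphere `∂B(x, r)` in `ℝ^{m+1}`, as a measure on `ℝ^{m+1}`: the
image of Lebesgue surface measure on the unit sphere under `ω ↦ x + r ω`, times `r ^ m`. -/
def sphereMeasure (x : EuclideanSpace ℝ (Fin (m + 1))) (r : ℝ) :
    Measure (EuclideanSpace ℝ (Fin (m + 1))) :=
  ENNReal.ofReal (r ^ m) •
    ((volume : Measure (EuclideanSpace ℝ (Fin (m + 1)))).toSphere).map
      (fun ω : Metric.sphere (0 : EuclideanSpace ℝ (Fin (m + 1))) 1 =>
        x + r • (ω : EuclideanSpace ℝ (Fin (m + 1))))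

/-- The integral `∫_{∂B(x, r)} f dS = ∑ t, b_t ∫_{∂B(x, r)} f_t dS` of an `A`-valued function. -/
def sphereIntegral (b : Module.Basis (Fin (d + 1)) ℝ A)
    (f : EuclideanSpace ℝ (Fin (m + 1)) → A) (x : EuclideanSpace ℝ (Fin (m + 1))) (r : ℝ) : A :=
  ∑ t, (∫ y, component b f t y ∂(sphereMeasure x r)) • b t

/-- `σ_m = 2 Γ(1/2)^{m+1} / Γ((m+1)/2)`. -/
def sphereArea (m : ℕ) : ℝ :=
  2 * Real.Gamma (1 / 2) ^ (m + 1) / Real.Gamma (((m : ℝ) + 1) / 2)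

/-- `σ_m` is the area of the unit sphere of `ℝ^{m+1}`. -/
theorem sphereMeasure_real_univ (m : ℕ) :
    (sphereMeasure (0 : EuclideanSpace ℝ (Fin (m + 1))) 1).real Set.univ = sphereArea m := by
  have hm : Measurable (fun ω : Metric.sphere (0 : EuclideanSpace ℝ (Fin (m + 1))) 1 =>
      (0 : EuclideanSpace ℝ (Fin (m + 1))) + (1 : ℝ) • (ω : EuclideanSpace ℝ (Fin (m + 1)))) := by
    fun_prop
  have hG : Real.Gamma (((m : ℝ) + 1) / 2 + 1)
      = ((m : ℝ) + 1) / 2 * Real.Gamma (((m : ℝ) + 1) / 2) :=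
    Real.Gamma_add_one (by positivity)
  have hpos : 0 < Real.Gamma (((m : ℝ) + 1) / 2) := Real.Gamma_pos_of_pos (by positivity)
  unfold sphereMeasure sphereArea
  rw [one_pow, ENNReal.ofReal_one, one_smul, measureReal_def, Measure.map_apply hm MeasurableSet.univ, Set.preimage_univ,
    Measure.toSphere_apply_univ, EuclideanSpace.volume_ball, Real.Gamma_one_half_eq]
  simp only [Fintype.card_fin, finrank_euclideanSpace, Nat.cast_add, Nat.cast_one, hG]
  simp only [ENNReal.ofReal_one, one_pow, one_mul]
  rw [ENNReal.toReal_mul, ENNReal.toReal_ofReal (by positivity)]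
  norm_cast
  push_cast
  field_simp

end Analysis

end Hypercomplex

end

/-! ### Spherical means and radial test fields -/

section Sphere

open Metric Set Filter Topology
open scoped ContDiff

/-! The conjugate operator turns the Cauchy-Riemann equation into Laplace's equation, but `f` is
only `C¹`, so this is done weakly and only against radial fields. With the centre at `0`, put `a s r
= ∫ p(‖y‖²) y_r ∂_s f`. The field `p(‖y‖²) y` is a gradient, so integration by parts makes `a`
symmetric (`integral_fderiv_mul_radial_comm`). Monogenicity gives `∑ s, v_s a s r = 0` for each `r`.
Multiplying by `star v_r`, summing over `r` and using the Clifford relations leaves `∑ s, a s s = 0`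
(`sum_diag_eq_zero`): the radial derivative of `f` integrates to zero against every `p(‖y‖²)`. This
needs only left alternativity, not associativity.

In polar coordinates the spherical integral of the radial derivative therefore vanishes at almost
every radius below `ε`. Integrating in the radius identifies the mean over the sphere with the value
at the centre (`integral_toSphere_eq_of_integral_radial_eq_zero`). -/

theorem hasCompactSupport_comp_norm_sq {E : Type*} [NormedAddCommGroup E] [ProperSpace E]
    {p : ℝ → ℝ} (hp : HasCompactSupport p) :
    HasCompactSupport fun y : E => p (‖y‖ ^ 2) := by
  rw [hasCompactSupport_iff_eventuallyEq, coclosedCompact_eq_cocompact] at hp ⊢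
  exact ((tendsto_pow_atTop two_ne_zero).comp (tendsto_norm_cocompact_atTop (E := E))).eventually
    (hp.filter_mono atTop_le_cocompact)

variable {E : Type*} [NormedAddCommGroup E] [MeasurableSpace E] [BorelSpace E]

/-- Integration in polar coordinates. -/
theorem integral_eq_integral_Ioi_toSphere [NormedSpace ℝ E] [FiniteDimensional ℝ E] [Nontrivial E]
    (μ : Measure E) [μ.IsAddHaarMeasure] {g : E → ℝ} (hg : Integrable g μ) :
    ∫ y, g y ∂μ = ∫ r in Ioi (0 : ℝ), r ^ (Module.finrank ℝ E - 1) *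
      ∫ w : sphere (0 : E) 1, g (r • (w : E)) ∂μ.toSphere := by
  have hmp := μ.measurePreserving_homeomorphUnitSphereProd
  have hemb := (homeomorphUnitSphereProd E).measurableEmbedding
  let G : sphere (0 : E) 1 × Ioi (0 : ℝ) → ℝ := fun z => g (z.2.1 • (z.1 : E))
  have hG : ∀ y : ({0}ᶜ : Set E), G (homeomorphUnitSphereProd E y) = g y := fun y => by
    have : ‖(y : E)‖ ≠ 0 := norm_ne_zero_iff.2 y.2
    simp [G, smul_smul, mul_inv_cancel₀ this]
  have hGi : Integrable G (μ.toSphere.prod (.volumeIoiPow (Module.finrank ℝ E - 1))) := by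
    rw [← hmp.integrable_comp_emb hemb]
    have : Integrable (g ∘ (Subtype.val : ({0}ᶜ : Set E) → E)) (μ.comap (↑)) :=
      (integrableOn_iff_comap_subtypeVal (measurableSet_singleton _).compl).1 hg.integrableOn
    exact this.congr (Eventually.of_forall fun y => (hG y).symm)
  calc ∫ y, g y ∂μ = ∫ y : ({0}ᶜ : Set E), g y ∂(μ.comap (↑)) := by
        rw [integral_subtype_comap (measurableSet_singleton _).compl g, restrict_compl_singleton]
    _ = ∫ z, G z ∂μ.toSphere.prod (.volumeIoiPow (Module.finrank ℝ E - 1)) := by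
        rw [← hmp.integral_comp hemb]
        simp only [hG]
    _ = ∫ r : Ioi (0 : ℝ), (∫ w : sphere (0 : E) 1, g (r.1 • (w : E)) ∂μ.toSphere)
          ∂(.volumeIoiPow (Module.finrank ℝ E - 1)) := integral_prod_symm _ hGi
    _ = _ := by
        simp only [Measure.volumeIoiPow, ENNReal.ofReal]
        rw [integral_withDensity_eq_integral_smul
            ((measurable_subtype_coe.pow_const _).real_toNNReal),
          integral_subtype_comap measurableSet_Ioi fun a : ℝ =>
            Real.toNNReal (a ^ (Module.finrank ℝ E - 1)) •
              ∫ w : sphere (0 : E) 1, g (a • (w : E)) ∂μ.toSphere]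
        refine setIntegral_congr_fun measurableSet_Ioi fun r hr => ?_
        simp only [NNReal.smul_def, Real.coe_toNNReal _ (pow_nonneg (le_of_lt hr) _), smul_eq_mul]

/-- A test function on `(0, R)`, composed with the square root, is a test function on
`(0, R ^ 2)`. -/
theorem exists_contDiff_comp_sq {R : ℝ} {φ : ℝ → ℝ} (hφ : ContDiff ℝ ∞ φ)
    (hc : HasCompactSupport φ) (hs : tsupport φ ⊆ Ioo 0 R) :
    ∃ p : ℝ → ℝ, ContDiff ℝ ∞ p ∧ HasCompactSupport p ∧ tsupport p ⊆ Ioo 0 (R ^ 2) ∧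
      ∀ r, 0 ≤ r → p (r ^ 2) = φ r := by
  have hK : IsCompact ((fun s : ℝ => s ^ 2) '' tsupport φ) := hc.isCompact.image (by fun_prop)
  have hKs : (fun s : ℝ => s ^ 2) '' tsupport φ ⊆ Ioo 0 (R ^ 2) := by
    rintro _ ⟨s, h, rfl⟩
    have := hs h
    exact ⟨pow_pos this.1 2, pow_lt_pow_left₀ this.2 this.1.le two_ne_zero⟩
  -- This includes `t ≤ 0`: there `√t = 0`, which lies outside the support of `φ`. The singularity
  -- of the square root at `0` is thus harmless.
  have h0 : ∀ t, t ∉ (fun s : ℝ => s ^ 2) '' tsupport φ → φ (√t) = 0 := fun t ht => by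
    by_contra hne
    have h1 : √t ∈ tsupport φ := subset_tsupport _ hne
    have h2 : 0 < t := Real.sqrt_pos.1 (hs h1).1
    exact ht ⟨√t, h1, Real.sq_sqrt h2.le⟩
  refine ⟨fun t => φ (√t), contDiff_iff_contDiffAt.2 fun t => ?_, HasCompactSupport.intro hK h0,
    (closure_minimal (fun t (ht : φ (√t) ≠ 0) => by_contra fun h => ht (h0 t h)) hK.isClosed).trans hKs,
    fun r hr => by simp [Real.sqrt_sq hr]⟩
  rcases eq_or_ne t 0 with rfl | ht
  · have : (fun t => φ (√t)) =ᶠ[𝓝 0] fun _ => 0 := by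
      filter_upwards [hK.isClosed.isOpen_compl.mem_nhds fun h => (hKs h).1.ne rfl] with t ht
      exact h0 t ht
    exact contDiffAt_const.congr_of_eventuallyEq this
  · exact hφ.contDiffAt.comp t (Real.contDiffAt_sqrt ht)

/-- Partial derivatives of `u` integrate symmetrically against a radial (hence gradient) vector
field. -/
theorem integral_fderiv_mul_radial_comm [InnerProductSpace ℝ E] [FiniteDimensional ℝ E]
    (μ : Measure E) [μ.IsAddHaarMeasure] {u : E → ℝ} (hu : ContDiff ℝ 1 u) {p : ℝ → ℝ}
    (hp : ContDiff ℝ ∞ p) (hpc : HasCompactSupport p) (a b : E) :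
    ∫ y, fderiv ℝ u y a * (p (‖y‖ ^ 2) * inner ℝ b y) ∂μ =
      ∫ y, fderiv ℝ u y b * (p (‖y‖ ^ 2) * inner ℝ a y) ∂μ := by
  have hu' : Continuous (fderiv ℝ u) := hu.continuous_fderiv (by simp)
  let g : E → E → ℝ := fun c y => p (‖y‖ ^ 2) * inner ℝ c y
  have hg : ∀ c, ContDiff ℝ 1 (g c) := fun c =>
    ((hp.of_le (by simp)).comp (contDiff_norm_sq ℝ)).mul (contDiff_const.inner ℝ contDiff_id)
  have hgc : ∀ c, HasCompactSupport (g c) := fun c =>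
    (hasCompactSupport_comp_norm_sq hpc).mul_right
  -- The right side is symmetric in `c` and `e`: the field `p(‖y‖²) y` has a symmetric Jacobian.
  have hg' : ∀ c e y, fderiv ℝ (g c) y e =
      p (‖y‖ ^ 2) * inner ℝ c e + inner ℝ c y * (deriv p (‖y‖ ^ 2) * (2 * inner ℝ y e)) := by
    intro c e y
    have h1 : HasFDerivAt (fun y : E => p (‖y‖ ^ 2)) _ y :=
      (hp.differentiable (by simp) _).hasDerivAt.comp_hasFDerivAt y
        (hasStrictFDerivAt_norm_sq y).hasFDerivAt
    have h2 : HasFDerivAt (fun y : E => inner ℝ c y) (innerSL ℝ c) y := (innerSL ℝ c).hasFDerivAt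
    rw [show fderiv ℝ (g c) y = _ from (h1.mul h2).fderiv]
    simp
  have key : ∀ c e, ∫ y, u y * fderiv ℝ (g c) y e ∂μ = -∫ y, fderiv ℝ u y e * g c y ∂μ := by
    intro c e
    have hgc' : HasCompactSupport fun y => fderiv ℝ (g c) y e := (hgc c).fderiv_apply ℝ e
    have hgd : Continuous (fderiv ℝ (g c)) := (hg c).continuous_fderiv (by simp)
    have hgcont := (hg c).continuous
    have hucont := hu.continuous
    refine integral_mul_fderiv_eq_neg_fderiv_mul_of_integrable ?_ ?_ ?_
      (fun y _ => hu.differentiable (by simp) y) (fun y _ => (hg c).differentiable (by simp) y)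
    · exact Continuous.integrable_of_hasCompactSupport (by fun_prop) (hgc c).mul_left
    · exact Continuous.integrable_of_hasCompactSupport (by fun_prop) hgc'.mul_left
    · exact Continuous.integrable_of_hasCompactSupport (by fun_prop) (hgc c).mul_left
  have h := key b a
  rw [← neg_inj, ← key b a, ← key a b]
  refine integral_congr_ae (Eventually.of_forall fun y => ?_)
  simp only [hg', real_inner_comm]
  ring

/-- If the radial derivative of `u` is orthogonal to all radial test functions on the ball of
radius `R`, then the mean of `u` over the sphere of radius `R` is its value at the centre. -/
theorem integral_toSphere_eq_of_integral_radial_eq_zero [InnerProductSpace ℝ E]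
    [FiniteDimensional ℝ E] [Nontrivial E] (μ : Measure E) [μ.IsAddHaarMeasure]
    {u : E → ℝ} (hu : ContDiff ℝ 1 u) {R : ℝ} (hR : 0 < R)
    (h : ∀ p : ℝ → ℝ, ContDiff ℝ ∞ p → HasCompactSupport p → tsupport p ⊆ Ioo 0 (R ^ 2) →
      ∫ y, p (‖y‖ ^ 2) * fderiv ℝ u y y ∂μ = 0) :
    ∫ w : sphere (0 : E) 1, u (R • (w : E)) ∂μ.toSphere = μ.toSphere.real univ * u 0 := by
  have hu' : Continuous (fderiv ℝ u) := hu.continuous_fderiv (by simp)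
  let D : ℝ → sphere (0 : E) 1 → ℝ := fun r w => fderiv ℝ u (r • (w : E)) w
  have hD : Continuous (Function.uncurry D) := by
    simp only [D, Function.uncurry_def]; fun_prop
  let G : ℝ → ℝ := fun r => ∫ w, D r w ∂μ.toSphere
  have hG : Continuous G := by
    have := continuous_parametric_integral_of_continuous (μ := μ.toSphere) hD isCompact_univ
    simpa [G] using this
  -- Fundamental lemma of the calculus of variations. The extra factor `r` arises because the
  -- derivative is taken along `y = r w`, not along the unit vector `w`.
  have hG0 : ∀ᵐ r, r ∈ Ioo 0 R → r ^ (Module.finrank ℝ E - 1) * (r * G r) = 0 := by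
    refine isOpen_Ioo.ae_eq_zero_of_integral_contDiff_smul_eq_zero
      (Continuous.locallyIntegrable (by fun_prop) |>.locallyIntegrableOn _) fun φ hφ hc hs => ?_
    obtain ⟨p, hp, hpc, hps, hpφ⟩ := exists_contDiff_comp_sq hφ hc hs
    have hpi : Integrable (fun y => p (‖y‖ ^ 2) * fderiv ℝ u y y) μ := by
      exact ((hp.continuous.comp (by fun_prop)).mul (by fun_prop)).integrable_of_hasCompactSupport
        (hasCompactSupport_comp_norm_sq hpc).mul_right
    have := h p hp hpc hps
    rw [integral_eq_integral_Ioi_toSphere μ hpi] at this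
    rw [← this, ← setIntegral_eq_integral_of_forall_compl_eq_zero (s := Ioi 0)]
    · refine setIntegral_congr_fun measurableSet_Ioi fun r hr => ?_
      have hr : 0 < r := hr
      have h1 : ∀ w : sphere (0 : E) 1,
          p (‖r • (w : E)‖ ^ 2) * fderiv ℝ u (r • (w : E)) (r • (w : E)) = φ r * r * D r w :=
        fun w => by
          simp [norm_smul, abs_of_pos hr, D, hpφ _ hr.le, mul_assoc]
      simp only [h1, integral_const_mul, smul_eq_mul, G]
      ring
    · intro r hr
      have : φ r = 0 := image_eq_zero_of_notMem_tsupport fun h => hr (hs h).1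
      simp [this]
  -- `D r w` is the derivative of `u` along the ray through `w`.
  have hint : ∀ w : sphere (0 : E) 1, ∫ r in (0)..R, D r w = u (R • (w : E)) - u 0 := fun w => by
    have hd : ∀ r ∈ uIcc 0 R, HasDerivAt (fun r : ℝ => u (r • (w : E))) (D r w) r := fun r _ => by
      have h1 : HasDerivAt (fun r : ℝ => r • (w : E)) (w : E) r := by
        simpa using (hasDerivAt_id r).smul_const (w : E)
      exact ((hu.differentiable (by simp) _).hasFDerivAt.comp_hasDerivAt r h1)
    rw [intervalIntegral.integral_eq_sub_of_hasDerivAt hd]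
    · simp
    · exact (hD.comp (by fun_prop : Continuous fun r => (r, w))).intervalIntegrable _ _
  have hswap : ∫ w, (∫ r in (0)..R, D r w) ∂μ.toSphere = ∫ r in (0)..R, G r := by
    simp only [intervalIntegral.integral_of_le hR.le]
    refine integral_integral_swap ?_
    have hi : IntegrableOn (Function.uncurry fun w r => D r w) (univ ×ˢ Icc 0 R)
        (μ.toSphere.prod volume) :=
      (hD.comp continuous_swap).continuousOn.integrableOn_compact (isCompact_univ.prod isCompact_Icc)
    have := hi.mono_set (prod_mono subset_rfl (Ioc_subset_Icc_self (a := (0 : ℝ)) (b := R)))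
    rwa [IntegrableOn, ← Measure.prod_restrict, Measure.restrict_univ] at this
  have hzero : ∫ r in (0)..R, G r = 0 := by
    rw [intervalIntegral.integral_of_le hR.le, integral_Ioc_eq_integral_Ioo]
    refine setIntegral_eq_zero_of_ae_eq_zero ?_
    filter_upwards [hG0] with r hr hm
    have := hm.1.ne'
    simpa [this] using hr hm
  have hui : Integrable (fun w : sphere (0 : E) 1 => u (R • (w : E))) μ.toSphere :=
    Continuous.integrable_of_hasCompactSupport (hu.continuous.comp (by fun_prop))
      (HasCompactSupport.of_compactSpace _)
  rw [hzero] at hswap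
  simp only [hint] at hswap
  rw [integral_sub hui (integrable_const _), integral_const, sub_eq_zero] at hswap
  simpa using hswap

end Sphere

/-! ### Clifford relations without associativity -/

section Algebra

variable {A : Type*} [NonAssocRing A]

/-- Polarisation of the left alternative law `(x x) c = x (x c)` at `x = a + b`. -/
theorem Hypercomplex.IsAlternative.mul_mul_add_mul_mul (hA : Hypercomplex.IsAlternative A)
    (a b c : A) : a * (b * c) + b * (a * c) = (a * b + b * a) * c := by
  have h : ∀ x : A, x * x * c = x * (x * c) := fun x => sub_eq_zero.1 (hA x c).1
  have hab := h (a + b)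
  simp only [add_mul, mul_add, h] at hab ⊢
  rw [← sub_eq_zero] at hab ⊢
  rw [← neg_eq_zero, ← hab]
  abel

variable [StarRing A]

/-- Anticommuting imaginary units together with `1` satisfy the Clifford relations. -/
theorem Hypercomplex.star_mul_mul_add_star_mul_mul (hA : Hypercomplex.IsAlternative A) {m : ℕ}
    {v : Fin (m + 1) → A} (h0 : v 0 = 1) (h1 : ∀ s, s ≠ 0 → v s ∈ Hypercomplex.imaginaryUnits A)
    (h2 : ∀ s t, s ≠ 0 → t ≠ 0 → s ≠ t → v s * v t = -(v t * v s)) (r s : Fin (m + 1)) (a : A) :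
    star (v r) * (v s * a) + star (v s) * (v r * a) = if r = s then a + a else 0 := by
  have hstar : ∀ s, s ≠ 0 → star (v s) = -v s := fun s hs => eq_neg_of_add_eq_zero_right (h1 s hs).1
  have hsq : ∀ s, s ≠ 0 → v s * v s = -1 := fun s hs => by
    have := (h1 s hs).2
    rw [hstar s hs, mul_neg] at this
    rw [← this, neg_neg]
  by_cases hr : r = 0 <;> by_cases hs : s = 0
  · subst hr hs
    simp [h0]
  · subst hr
    simp [h0, hstar s hs, Ne.symm hs]
  · subst hs
    simp [h0, hstar r hr, hr]
  · rw [hstar r hr, hstar s hs, neg_mul, neg_mul, ← neg_add, hA.mul_mul_add_mul_mul]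
    split_ifs with h
    · subst h
      simp [hsq r hr, add_mul]
    · simp [h2 r s hr hs h]

/-- Weak form of "conjugate operator times operator is the Laplacian", with `a s r` in the role of a
Hessian. In `∑ star (v r) * (v s * a s r)`, symmetry of `a` pairs `(r, s)` with `(s, r)`; the
Clifford relations cancel the off-diagonal pairs. -/
theorem Hypercomplex.sum_diag_eq_zero [Module ℝ A] (hA : Hypercomplex.IsAlternative A) {m : ℕ}
    {v : Fin (m + 1) → A} (h0 : v 0 = 1) (h1 : ∀ s, s ≠ 0 → v s ∈ Hypercomplex.imaginaryUnits A)
    (h2 : ∀ s t, s ≠ 0 → t ≠ 0 → s ≠ t → v s * v t = -(v t * v s))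
    {a : Fin (m + 1) → Fin (m + 1) → A} (ha : ∀ s r, a s r = a r s)
    (hz : ∀ r, ∑ s, v s * a s r = 0) : ∑ s, a s s = 0 := by
  have hz' : ∑ r, ∑ s, star (v r) * (v s * a s r) = 0 := by
    simp only [← Finset.mul_sum, hz, mul_zero, Finset.sum_const_zero]
  have h : (∑ r, ∑ s, star (v r) * (v s * a s r)) + ∑ r, ∑ s, star (v r) * (v s * a s r)
      = ∑ r, (a r r + a r r) := by
    conv_lhs => enter [2]; rw [Finset.sum_comm]
    rw [← Finset.sum_add_distrib]
    refine Finset.sum_congr rfl fun r _ => ?_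
    rw [← Finset.sum_add_distrib]
    trans ∑ s, if r = s then a s r + a s r else 0
    · refine Finset.sum_congr rfl fun s _ => ?_
      rw [← Hypercomplex.star_mul_mul_add_star_mul_mul hA h0 h1 h2 r s (a s r), ha s r]
    · simp
  rw [hz', add_zero, Finset.sum_add_distrib, ← two_smul ℝ] at h
  exact (smul_eq_zero.1 h.symm).resolve_left two_ne_zero

end Algebra

/-! ### From the Cauchy-Riemann equation to the mean value formula -/

section Monogenic

open Metric Set Filter Topology
open scoped ContDiff

theorem contDiff_mul_of_tsupport_subset {E : Type*} [NormedAddCommGroup E] [NormedSpace ℝ E]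
    {n : WithTop ℕ∞} {χ g : E → ℝ} {U : Set E} (hχ : ContDiff ℝ n χ) (hU : IsOpen U)
    (hg : ContDiffOn ℝ n g U) (hs : tsupport χ ⊆ U) : ContDiff ℝ n fun y => χ y * g y := by
  refine contDiff_iff_contDiffAt.2 fun y => ?_
  by_cases hy : y ∈ tsupport χ
  · exact hχ.contDiffAt.mul (hg.contDiffAt (hU.mem_nhds (hs hy)))
  · refine (contDiffAt_const (c := (0 : ℝ))).congr_of_eventuallyEq ?_
    filter_upwards [notMem_tsupport_iff_eventuallyEq.1 hy] with z hz
    simp [hz]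

/-- A function which is `C^n` on a neighbourhood of a closed ball agrees on that ball with a
`C^n` function on the whole space. -/
theorem exists_contDiff_eqOn_closedBall {E : Type*} [NormedAddCommGroup E] [InnerProductSpace ℝ E]
    [FiniteDimensional ℝ E] {n : ℕ∞} {g : E → ℝ} {U : Set E} (hU : IsOpen U)
    (hg : ContDiffOn ℝ n g U) {x : E} {R : ℝ} (hR : 0 < R) (hb : closedBall x R ⊆ U) :
    ∃ u : E → ℝ, ContDiff ℝ n u ∧ EqOn u g (closedBall x R) := by
  obtain ⟨δ, hδ, h⟩ := (isCompact_closedBall x R).exists_cthickening_subset_open hU hb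
  rw [cthickening_closedBall hδ.le hR.le] at h
  -- Equal to `1` on the given ball, with support in its `δ`-thickening, which still lies in `U`.
  let χ : ContDiffBump x := ⟨R, δ + R, hR, by linarith⟩
  refine ⟨fun y => χ y * g y, contDiff_mul_of_tsupport_subset χ.contDiff hU hg ?_, fun y hy => ?_⟩
  · rw [χ.tsupport_eq]
    exact (closedBall_subset_closedBall (by simp [χ, add_comm])).trans h
  · simp [χ.one_of_mem_closedBall hy]

variable {A : Type*} [NonAssocRing A] [Module ℝ A] [SMulCommClass ℝ A A]
  [StarRing A] {m d : ℕ}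

/-- If the Cauchy-Riemann operator annihilates a `C^1` function on a ball, the radial derivatives
of its components are orthogonal to all radial test functions on this ball. -/
theorem Hypercomplex.integral_radial_eq_zero (hA : Hypercomplex.IsAlternative A)
    {v : Fin (m + 1) → A} (h0 : v 0 = 1) (h1 : ∀ s, s ≠ 0 → v s ∈ Hypercomplex.imaginaryUnits A)
    (h2 : ∀ s t, s ≠ 0 → t ≠ 0 → s ≠ t → v s * v t = -(v t * v s))
    (b : Module.Basis (Fin (d + 1)) ℝ A) {u : Fin (d + 1) → EuclideanSpace ℝ (Fin (m + 1)) → ℝ}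
    (hu : ∀ t, ContDiff ℝ 1 (u t)) {R : ℝ} (hR : 0 < R)
    (hz : ∀ y ∈ ball (0 : EuclideanSpace ℝ (Fin (m + 1))) R,
      ∑ s, ∑ t, fderiv ℝ (u t) y (EuclideanSpace.single s 1) • (v s * b t) = 0)
    {p : ℝ → ℝ} (hp : ContDiff ℝ ∞ p) (hpc : HasCompactSupport p)
    (hps : tsupport p ⊆ Ioo 0 (R ^ 2)) (t : Fin (d + 1)) :
    ∫ y, p (‖y‖ ^ 2) * fderiv ℝ (u t) y y = 0 := by
  let e : Fin (m + 1) → EuclideanSpace ℝ (Fin (m + 1)) := fun s => EuclideanSpace.single s 1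
  let F : Fin (m + 1) → Fin (m + 1) → Fin (d + 1) → EuclideanSpace ℝ (Fin (m + 1)) → ℝ :=
    fun s r t y => fderiv ℝ (u t) y (e s) * (p (‖y‖ ^ 2) * inner ℝ (e r) y)
  have hF : ∀ s r t, Integrable (F s r t) := fun s r t => by
    have := (hu t).continuous_fderiv (by simp)
    have hpcont : Continuous fun y : EuclideanSpace ℝ (Fin (m + 1)) => p (‖y‖ ^ 2) :=
      hp.continuous.comp (by fun_prop)
    exact Continuous.integrable_of_hasCompactSupport (by fun_prop)
      (hasCompactSupport_comp_norm_sq hpc).mul_right.mul_left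
  let a : Fin (m + 1) → Fin (m + 1) → A := fun s r => ∑ t, (∫ y, F s r t y) • b t
  have ha : ∀ s r, a s r = a r s := fun s r => Finset.sum_congr rfl fun t _ => by
    simp only [F, integral_fderiv_mul_radial_comm volume (hu t) hp hpc (e s) (e r)]
  -- The equation is known only on the ball; outside it `p(‖y‖²)` vanishes.
  have hz0 : ∀ r y, ∑ s, ∑ t, F s r t y • (v s * b t) = 0 := fun r y => by
    by_cases hy : y ∈ ball (0 : EuclideanSpace ℝ (Fin (m + 1))) R
    · have := congrArg (fun z : A => (p (‖y‖ ^ 2) * inner ℝ (e r) y) • z) (hz y hy)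
      simpa only [Finset.smul_sum, smul_smul, smul_zero, mul_comm, F, e] using this
    · have : p (‖y‖ ^ 2) = 0 := image_eq_zero_of_notMem_tsupport fun h =>
        hy (by simpa using lt_of_pow_lt_pow_left₀ 2 hR.le (hps h).2)
      simp [F, this]
  have hav : ∀ r, ∑ s, v s * a s r = 0 := fun r => by
    -- `A` carries no topology, so sums and integrals are exchanged on real coordinates.
    refine b.ext_elem fun k => ?_
    have hk : ∀ y, ∑ s, ∑ t, F s r t y * b.repr (v s * b t) k = 0 := fun y => by
      simpa using congrArg (fun z => b.repr z k) (hz0 r y)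
    calc b.repr (∑ s, v s * a s r) k
        = ∑ s, ∑ t, (∫ y, F s r t y) * b.repr (v s * b t) k := by
          simp [a, Finset.mul_sum, mul_smul_comm]
      _ = ∫ y, ∑ s, ∑ t, F s r t y * b.repr (v s * b t) k := by
          rw [integral_finsetSum _ fun s _ => integrable_finsetSum _ fun t _ =>
            (hF s r t).mul_const _]
          refine Finset.sum_congr rfl fun s _ => ?_
          rw [integral_finsetSum _ fun t _ => (hF s r t).mul_const _]
          simp only [integral_mul_const]
      _ = b.repr 0 k := by simp [hk]
  have hsum := congrArg (fun z => b.repr z t)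
    (Hypercomplex.sum_diag_eq_zero hA h0 h1 h2 ha hav)
  have hsum' : ∑ s, ∫ y, F s s t y = 0 := by
    simpa [a, Finsupp.single_apply] using hsum
  rw [← hsum', ← integral_finsetSum _ fun s _ => hF s s t]
  refine integral_congr_ae (Eventually.of_forall fun y => ?_)
  have hy : y = ∑ s, y s • e s := by
    simpa [e] using ((EuclideanSpace.basisFun (Fin (m + 1)) ℝ).sum_repr y).symm
  have : fderiv ℝ (u t) y y = ∑ s, y s * fderiv ℝ (u t) y (e s) := by
    conv_lhs => arg 2; rw [hy]
    simp
  simp only [this, Finset.mul_sum, F]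
  refine Finset.sum_congr rfl fun s _ => ?_
  have hs : inner ℝ (e s) y = y s := by
    rw [EuclideanSpace.inner_single_left]
    simp
  rw [hs]
  ring

theorem Hypercomplex.toSphere_real_univ_eq_sphereArea :
    (volume : Measure (EuclideanSpace ℝ (Fin (m + 1)))).toSphere.real univ =
      Hypercomplex.sphereArea m := by
  rw [← Hypercomplex.sphereMeasure_real_univ, Hypercomplex.sphereMeasure, measureReal_def,
    measureReal_def, one_pow, ENNReal.ofReal_one, one_smul,
    Measure.map_apply (by fun_prop) MeasurableSet.univ, preimage_univ]

theorem Hypercomplex.integral_sphereMeasure (g : EuclideanSpace ℝ (Fin (m + 1)) → ℝ)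
    (x : EuclideanSpace ℝ (Fin (m + 1))) {r : ℝ} (hr : 0 < r) :
    ∫ y, g y ∂(Hypercomplex.sphereMeasure x r) =
      r ^ m * ∫ w : sphere (0 : EuclideanSpace ℝ (Fin (m + 1))) 1, g (x + r • (w : _))
        ∂(volume : Measure (EuclideanSpace ℝ (Fin (m + 1)))).toSphere := by
  have hc : Continuous fun w : sphere (0 : EuclideanSpace ℝ (Fin (m + 1))) 1 =>
      x + r • (w : EuclideanSpace ℝ (Fin (m + 1))) := by fun_prop
  -- An embedding permits the change of variables with no measurability condition on `g`.
  have hinj : Function.Injective fun w : sphere (0 : EuclideanSpace ℝ (Fin (m + 1))) 1 =>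
      x + r • (w : EuclideanSpace ℝ (Fin (m + 1))) := fun w w' h => by
    have : r • (w : EuclideanSpace ℝ (Fin (m + 1))) = r • (w' : EuclideanSpace ℝ (Fin (m + 1))) :=
      add_left_cancel h
    exact Subtype.ext (smul_right_injective _ hr.ne' this)
  rw [Hypercomplex.sphereMeasure, integral_smul_measure,
    (hc.isClosedEmbedding hinj).measurableEmbedding.integral_map,
    ENNReal.toReal_ofReal (by positivity), smul_eq_mul]

end Monogenic

/-- Mean value theorem for monogenic functions on a hypercomplex subspace of a real
alternative `*`-algebra. -/
theorem mainTheorem7 {A : Type*} [NonAssocRing A] [Module ℝ A] [IsScalarTower ℝ A A]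
    [SMulCommClass ℝ A A] [StarRing A] [StarModule ℝ A]
    (hA : Hypercomplex.IsAlternative A)
    {m d : ℕ} (M : Submodule ℝ A) (hM : Hypercomplex.IsHypercomplexSubspace M)
    (v : Module.Basis (Fin (m + 1)) ℝ M) (hv : Hypercomplex.IsHypercomplexBasis v)
    (hmd : m ≤ d) (b : Module.Basis (Fin (d + 1)) ℝ A)
    (hb : ∀ s : Fin (m + 1), b (Fin.castLE (Nat.succ_le_succ hmd) s) = (v s : A))
    (Ω : Set (EuclideanSpace ℝ (Fin (m + 1)))) (hΩ : IsOpen Ω) (hΩc : IsConnected Ω)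
    (f : EuclideanSpace ℝ (Fin (m + 1)) → A) (hf : Hypercomplex.IsMonogenicOn v b f Ω)
    (x : EuclideanSpace ℝ (Fin (m + 1))) (ε : ℝ) (hε : 0 < ε)
    (hball : Metric.closedBall x ε ⊆ Ω) :
    f x = (1 / (Hypercomplex.sphereArea m * ε ^ m)) • Hypercomplex.sphereIntegral b f x ε := by
  obtain ⟨-, h0, h1, h2⟩ := hv
  -- Global `C¹` replacements for the components, equal to them on the closed ball: the interior
  -- carries the equation, the boundary sphere the mean.
  choose u hu huf using fun t => exists_contDiff_eqOn_closedBall (n := 1) hΩ (hf.1 t) hε hball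
  have hu' : ∀ t, ContDiff ℝ 1 fun y => u t (x + y) := fun t =>
    (hu t).comp (contDiff_const.add contDiff_id)
  have hcr : ∀ y ∈ Metric.ball (0 : EuclideanSpace ℝ (Fin (m + 1))) ε,
      ∑ s, ∑ t, fderiv ℝ (fun y => u t (x + y)) y (EuclideanSpace.single s 1) •
        ((v s : A) * b t) = 0 := fun y hy => by
    have hxy : x + y ∈ Metric.ball x ε := by simpa using hy
    rw [← hf.2 (x + y) (hball (Metric.ball_subset_closedBall hxy)), Hypercomplex.cauchyRiemann]
    refine Finset.sum_congr rfl fun s _ => Finset.sum_congr rfl fun t _ => ?_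
    have : u t =ᶠ[nhds (x + y)] Hypercomplex.component b f t := by
      filter_upwards [Metric.isOpen_ball.mem_nhds hxy] with z hz
      exact huf t (Metric.ball_subset_closedBall hz)
    rw [fderiv_comp_add_left, this.fderiv_eq, Hypercomplex.partialDeriv]
  have hσ : 0 < Hypercomplex.sphereArea m := by
    have h1 : 0 < Real.Gamma (1 / 2) := Real.Gamma_pos_of_pos (by norm_num)
    have h2 : 0 < Real.Gamma (((m : ℝ) + 1) / 2) := Real.Gamma_pos_of_pos (by positivity)
    unfold Hypercomplex.sphereArea
    positivity
  refine b.ext_elem fun t => ?_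
  have hmean := integral_toSphere_eq_of_integral_radial_eq_zero volume (hu' t) hε fun p hp hpc hps =>
    Hypercomplex.integral_radial_eq_zero (v := fun s => (v s : A)) hA h0 h1 h2 b hu' hε hcr
      hp hpc hps t
  have hcomp : ∫ y, Hypercomplex.component b f t y ∂(Hypercomplex.sphereMeasure x ε) =
      ε ^ m * (Hypercomplex.sphereArea m * b.repr (f x) t) := by
    have h0 : u t x = b.repr (f x) t := huf t (Metric.mem_closedBall_self hε.le)
    rw [Hypercomplex.integral_sphereMeasure _ x hε, ← h0,
      ← Hypercomplex.toSphere_real_univ_eq_sphereArea]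
    rw [add_zero] at hmean
    rw [← hmean]
    congr 1
    refine integral_congr_ae (Filter.Eventually.of_forall fun w => (huf t ?_).symm)
    simp [norm_smul, abs_of_pos hε]
  have : b.repr (Hypercomplex.sphereIntegral b f x ε) t =
      ∫ y, Hypercomplex.component b f t y ∂(Hypercomplex.sphereMeasure x ε) := by
    simp [Hypercomplex.sphereIntegral, Finsupp.single_apply]
  rw [map_smul, Finsupp.smul_apply, this, hcomp, smul_eq_mul]
  field_simp
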